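/- Let $r\ge 2$ and let $\mathbb F_r=\langle s_1,\dots,s_r\rangle$ be the free group of rank $r$. Let $\Sigma=(\sigma_n\colon\mathbb F_r\to\mathrm{Sym}(V_n))_n$ be a sofic approximation, i.e. a sequence of maps with $V_n$ finite and non-empty, $|V_n|\to\infty$, such that for every finite $F\subset\mathbb F_r$ and $\delta>0$, for all large $n$, the proportion of $v\in V_n$ with $\sigma_n(\gamma)v\neq v$ for all $\gamma\in F\setminus\{1\}$ exceeds $1-\delta$, and so does the proportion of $v$ with $\sigma_n(\gamma_1\gamma_2)v=\sigma_n(\gamma_1)\sigma_n(\gamma_2)v$ for all $\gamma_1,\gamma_2\in F$. For $\mathbf x\in\{\pm1\}^{V_n}$ put $P^{\sigma_n}_{\mathbf x}=|V_n|^{-1}\sum_{v}\delta_{(\gamma\mapsto\mathbf x(\sigma_n(\gamma)v))}$, a probability measure on $\{\pm1\}^{\mathbb F_r}$. The sofic entropy of a probability measure $\mu$ on $\{\pm1\}^{\mathbb F_r}$ is $$h_\Sigma(\mu)=\inf_{\mathcal O\ni\mu}\limsup_{n\to\infty}\frac1{|V_n|}\log\bigl|\{\mathbf x\in\{\pm1\}^{V_n}: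 P^{\sigma_n}_{\mathbf x}\in\mathcal O\}\bigr|\in[-\infty,\infty),$$ the infimum being over weak-$*$ open neighbourhoods of $\mu$, with $\log 0=-\infty$. For $J>0$ let $u(\mathbf x)=-\frac J2\sum_{i=1}^r\bigl(\mathbf x(e)\mathbf x(s_i)+\mathbf x(e)\mathbf x(s_i^{-1})\bigr)$ be the specific energy of the Ising model with no external field, and let $\mathrm P_\Sigma(\mu)=h_\Sigma(\mu)-\int u\,d\mu$ be the pressure. A shift-invariant probability measure on $\{\pm1\}^{\mathbb F_r}$ (the shift being $(g\cdot\mathbf x)(h)=\mathbf x(hg)$) is a $\Sigma$-equilibrium state if it maximizes $\mathrm P_\Sigma$ among all shift-invariant probability measures. Let $\mu^{\mathrm{FB}}$ be the free-boundary Ising state, i.e. the homogeneous Markov chain on the Cayley tree with edges $\{g,s_ig\}$ which has uniform marginal on $\{\pm1\}$ at each vertex and flips the spin across each edge with probability $1/(e^{2J}+1)$. Let $$J_{uniq}(r)=\operatorname{artanh}\tfrac1{2r-1},\qquad J_{rec}(r)=\operatorname{artanh}\bigl((2r-1)^{-1/2}\bigr).$$ Then $2J_{uniq}(r)=\log\frac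 r{r-1}$, the measure $\mu^{\mathrm{FB}}$ is shift-invariant, and if $J\ge\min(2J_{uniq}(r),J_{rec}(r))$, then for every sofic approximation $\Sigma$ to $\mathbb F_r$ the state $\mu^{\mathrm{FB}}$ is not a $\Sigma$-equilibrium state. -/

import Mathlib

open MeasureTheory Filter Topology
open scoped ENNReal

noncomputable section

namespace SoficIsing

/-! ### Sofic approximations and sofic entropy of shift systems -/

section Sofic

variable {Γ : Type*} [Group Γ] {V : Type*} [Fintype V]

/-- The map `σ : Γ → Sym(V)` is `(F, δ)`-sofic: it is almost free and almost an action. -/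
def IsSoficMap (σ : Γ → Equiv.Perm V) (F : Finset Γ) (δ : ℝ) : Prop :=
  1 - δ < ({v : V | ∀ γ ∈ F, γ ≠ 1 → σ γ v ≠ v}.ncard : ℝ) / (Fintype.card V : ℝ) ∧
  1 - δ < ({v : V | ∀ γ₁ ∈ F, ∀ γ₂ ∈ F, σ (γ₁ * γ₂) v = σ γ₁ (σ γ₂ v)}.ncard : ℝ) /
      (Fintype.card V : ℝ)

/-- A (deterministic) sofic approximation: a sequence of maps `σ n : Γ → Sym(V n)` with
`|V n| → ∞` such that, for all `F` and `δ > 0`, `σ n` is `(F, δ)`-sofic for all large `n`. -/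
def IsSoficApproximation {V : ℕ → Type*} [∀ n, Fintype (V n)]
    (σ : ∀ n, Γ → Equiv.Perm (V n)) : Prop :=
  Tendsto (fun n => Fintype.card (V n)) atTop atTop ∧
  ∀ (F : Finset Γ) (δ : ℝ), 0 < δ → ∀ᶠ n in atTop, IsSoficMap (σ n) F δ

variable {A : Type*}

/-- The pullback name `Π_v^σ x ∈ A^Γ`, `γ ↦ x (σ(γ)(v))`. -/
def pullbackName (σ : Γ → Equiv.Perm V) (x : V → A) (v : V) : Γ → A :=
  fun γ => x (σ γ v)

/-- The shift action of `Γ` on `A^Γ` for which pullback names along an action are equivariant: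
`(g • x) h = x (h g)`, so that `Π_{σ(g) v} x = g • Π_v x` when `σ` is a homomorphism. -/
def shift (g : Γ) (x : Γ → A) : Γ → A := fun h => x (h * g)

variable [MeasurableSpace A]

/-- Shift-invariance of a probability measure on `A^Γ`. -/
def ShiftInvariant (μ : ProbabilityMeasure (Γ → A)) : Prop :=
  ∀ g : Γ, MeasurePreserving (shift g) (μ : Measure (Γ → A)) (μ : Measure (Γ → A))

/-- The empirical distribution `P_x^σ = |V|⁻¹ ∑_v δ_{Π_v^σ x}`. -/
def empirical [Nonempty V] (σ : Γ → Equiv.Perm V) (x : V → A) : ProbabilityMeasure (Γ → A) :=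
  ⟨((Fintype.card V : ℝ≥0∞)⁻¹) • ∑ v : V, Measure.dirac (pullbackName σ x v), by
    constructor
    simp only [Measure.smul_apply, Measure.finsetSum_apply, measure_univ, Finset.sum_const,
      Finset.card_univ, nsmul_eq_mul, mul_one, smul_eq_mul]
    exact ENNReal.inv_mul_cancel (by simp) (by simp)⟩

/-- The set `Ω(σ, O)` of models `x ∈ A^V` whose empirical distribution lies in `O`. -/
def models [Nonempty V] (σ : Γ → Equiv.Perm V) (O : Set (ProbabilityMeasure (Γ → A))) :
    Set (V → A) :=
  {x | empirical σ x ∈ O}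

variable [Countable Γ] [TopologicalSpace A] [DiscreteTopology A] [Finite A] [BorelSpace A]

/-- Sofic entropy over a sequence of maps,
`inf_{O ∋ μ open} limsup_n |V n|⁻¹ log |Ω(σ n, O)|`, with values in `[-∞, ∞]` and `log 0 = -∞`.
The topology on `ProbabilityMeasure` is the weak one. -/
def soficEntropy {V : ℕ → Type*} [∀ n, Fintype (V n)] [∀ n, Nonempty (V n)]
    (σ : ∀ n, Γ → Equiv.Perm (V n)) (μ : ProbabilityMeasure (Γ → A)) : EReal :=
  ⨅ (O : Set (ProbabilityMeasure (Γ → A))) (_ : IsOpen O) (_ : μ ∈ O),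
    limsup (fun n => ENNReal.log ((models (σ n) O).ncard : ℝ≥0∞) /
      (Fintype.card (V n) : EReal)) atTop

/-- The pressure of `μ` for the specific energy `u`: entropy minus mean energy. -/
def pressure {V : ℕ → Type*} [∀ n, Fintype (V n)] [∀ n, Nonempty (V n)]
    (σ : ∀ n, Γ → Equiv.Perm (V n)) (u : (Γ → A) → ℝ) (μ : ProbabilityMeasure (Γ → A)) : EReal :=
  soficEntropy σ μ - ((∫ x, u x ∂(μ : Measure (Γ → A)) : ℝ) : EReal)

/-- An equilibrium state over `σ`: a shift-invariant probability measure which maximizes the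
pressure among all shift-invariant probability measures. -/
def IsEquilibrium {V : ℕ → Type*} [∀ n, Fintype (V n)] [∀ n, Nonempty (V n)]
    (σ : ∀ n, Γ → Equiv.Perm (V n)) (u : (Γ → A) → ℝ) (μ : ProbabilityMeasure (Γ → A)) : Prop :=
  ShiftInvariant μ ∧
    ∀ ν : ProbabilityMeasure (Γ → A), ShiftInvariant ν → pressure σ u ν ≤ pressure σ u μ

end Sofic

/-! ### Homogeneous Markov chains on the Cayley graph of a free group

The Cayley graph is the one with edges `{g, sᵢ g}`, a `2r`-regular tree, on which the shift acts
by automorphisms. If the reduced word of `g ≠ 1` is `l₁ l₂ ⋯ lₙ`, the neighbour of `g` on the path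
to the root `1` is `l₂ ⋯ lₙ`. -/

section Chain

variable {r : ℕ} {A : Type*}

/-- The label of the vertex with the reduced word `w`, where `a` is the label of the root and
`y (g, b)` is the label which the vertex `g ≠ 1` takes when the next vertex on the path from `g`
to the root has the label `b`. -/
def propagate (a : A) (y : FreeGroup (Fin r) × A → A) : List (Fin r × Bool) → A
  | [] => a
  | l :: w => y (FreeGroup.mk (l :: w), propagate a y w)

/-- The configuration on the tree obtained by propagating labels outward from the root. -/
def treeConfig (z : A × (FreeGroup (Fin r) × A → A)) : FreeGroup (Fin r) → A :=
  fun g => propagate z.1 z.2 g.toWord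

theorem measurable_treeConfig [MeasurableSpace A] [Finite A] [MeasurableSingletonClass A] :
    Measurable (treeConfig (r := r) (A := A)) := by
  refine measurable_pi_iff.2 fun g => ?_
  unfold treeConfig
  generalize g.toWord = w
  induction w with
  | nil => exact measurable_fst
  | cons l w ih =>
    have h : Measurable (fun q : A × (FreeGroup (Fin r) × A → A) =>
        q.2 (FreeGroup.mk (l :: w), q.1)) :=
      measurable_from_prod_countable_right fun b =>
        measurable_pi_apply (X := fun _ : FreeGroup (Fin r) × A => A) (FreeGroup.mk (l :: w), b)
    exact h.comp (ih.prodMk measurable_snd)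

/-- The (law of the) Markov chain indexed by the tree `F_r` with the root marginal `π` and the
transition kernel `P` across every edge, directed away from the root: the root label is drawn from
`π`, and independently, for each vertex `g` and each label `b`, the label that `g` takes if its
parent is labelled `b` is drawn from `P b`. -/
def treeMarkovChain (r : ℕ) [MeasurableSpace A] [Finite A] [MeasurableSingletonClass A]
    (π : ProbabilityMeasure A) (P : A → ProbabilityMeasure A) :
    ProbabilityMeasure (FreeGroup (Fin r) → A) :=
  ⟨((π : Measure A).prod
      (Measure.infinitePi fun p : FreeGroup (Fin r) × A => (P p.2 : Measure A))).map treeConfig,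
    Measure.isProbabilityMeasure_map measurable_treeConfig.aemeasurable⟩

end Chain

/-! ### The Ising model -/

/-- The two spins; `true` stands for `+1` and `false` for `-1`. -/
abbrev Spin : Type := Bool

/-- The numerical value `±1` of a spin. -/
def Spin.val (s : Spin) : ℝ := if s then 1 else -1

/-- The law on spins which gives `-1` the probability `p` and `+1` the probability `1 - p`. -/
def spinLaw (p : unitInterval) : ProbabilityMeasure Spin :=
  ⟨ENNReal.ofReal (p : ℝ) • Measure.dirac false + ENNReal.ofReal (1 - (p : ℝ)) • Measure.dirac true,
    by
      constructor
      simp only [Measure.add_apply, Measure.smul_apply, measure_univ, smul_eq_mul, mul_one]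
      rw [← ENNReal.ofReal_add p.2.1 (sub_nonneg.2 p.2.2)]
      simp⟩

/-- The specific energy at the identity,
`u(x) = -(J/2) ∑ᵢ (x(e) x(sᵢ) + x(e) x(sᵢ⁻¹))`. -/
def isingEnergy (r : ℕ) (J : ℝ) (x : FreeGroup (Fin r) → Spin) : ℝ :=
  -(J / 2) * ∑ i : Fin r,
    ((x 1).val * (x (FreeGroup.of i)).val + (x 1).val * (x (FreeGroup.of i)⁻¹).val)

/-- The probability `α(t)` of the spin `-1` at a vertex. -/
def isingAlpha (J t : ℝ) : unitInterval :=
  ⟨(Real.exp (-2 * J) + Real.exp (-2 * t)) / (2 * Real.exp (-2 * J) + 2 * Real.cosh (2 * t)), by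
    have h1 := Real.exp_pos (-2 * J)
    have h2 := Real.exp_pos (-2 * t)
    have h3 := Real.exp_pos (2 * t)
    have h4 : 2 * Real.cosh (2 * t) = Real.exp (2 * t) + Real.exp (-2 * t) := by
      rw [Real.cosh_eq]; ring_nf
    rw [h4]
    refine ⟨by positivity, (div_le_one (by positivity)).2 (by linarith)⟩⟩

/-- The transition probability `β(t)` from `+1` to `-1`. -/
def isingBeta (J t : ℝ) : unitInterval :=
  ⟨1 / (Real.exp (2 * (J + t)) + 1), by
    have h := Real.exp_pos (2 * (J + t))
    refine ⟨by positivity, (div_le_one (by positivity)).2 (by linarith)⟩⟩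

/-- The completely homogeneous Markov chain `μ_t`: single-site marginal `(α(t), 1 - α(t))` on
`(-1, +1)`, transition probabilities `β(t)` from `+1` to `-1` and `β(-t)` from `-1` to `+1`. -/
def isingChain (r : ℕ) (J t : ℝ) : ProbabilityMeasure (FreeGroup (Fin r) → Spin) :=
  treeMarkovChain r (spinLaw (isingAlpha J t)) fun s =>
    if s then spinLaw (isingBeta J t) else spinLaw (unitInterval.symm (isingBeta J (-t)))

/-- The free-boundary Ising state `μ^FB = μ_0`. -/
def freeBoundaryState (r : ℕ) (J : ℝ) : ProbabilityMeasure (FreeGroup (Fin r) → Spin) :=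
  isingChain r J 0

/-- The uniqueness threshold. -/
def Juniq (r : ℕ) : ℝ := Real.artanh (1 / (2 * (r : ℝ) - 1))

/-- The reconstruction threshold. -/
def Jrec (r : ℕ) : ℝ := Real.artanh ((2 * (r : ℝ) - 1) ^ (-(1 / 2) : ℝ))

end SoficIsing

end

/-! The all-plus point mass has strictly larger pressure. It has nonnegative entropy, since the
constant configuration is an exact model, and energy -rJ, so its pressure is at least rJ
(`le_pressure_plusState`).

For the free-boundary state one generator s gives enough of an entropy bound. A model of it flips
along σ(s) at frequency about β = 1/(e^{2J}+1). By soficity σ(s) has few short cycles, hence o(|V|)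
cycles, and a configuration is determined by its flip set and one bit per cycle. Chernoff's bound
for the flip sets then bounds the entropy by 2Jβ + log(1+e^{-2J}), the binary entropy of β
(`soficEntropy_le_of_flip_lt`). The energy is -rJ(1-2β), so the pressure is below rJ once
log(1+e^{-2J}) < 2(r-1)Jβ (`pressure_freeBoundaryState_lt`).

Since log(1+x) < x, this follows from 1+e^{-2J} ≤ 2(r-1)J, a condition that persists as J grows
(`log_one_add_exp_lt_of_le`). It is checked at each of the two thresholds.

Shift-invariance holds because cylinder probabilities over subtrees are products of symmetric edge
weights and so do not depend on the root. -/

noncomputable section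

namespace SoficIsing

/-! ### The Cayley tree -/

section Tree

variable {r : ℕ}

/-- The neighbour of `g` on the path from `g` to the root `1` (and `1` itself if `g = 1`). -/
def parent (g : FreeGroup (Fin r)) : FreeGroup (Fin r) := FreeGroup.mk g.toWord.tail

theorem toWord_parent (g : FreeGroup (Fin r)) : (parent g).toWord = g.toWord.tail := by
  rw [parent, FreeGroup.toWord_mk]
  exact FreeGroup.IsReduced.reduce_eq (List.IsChain.tail FreeGroup.isReduced_toWord)

@[simp]
theorem parent_one : parent (1 : FreeGroup (Fin r)) = 1 := by
  simp [parent, FreeGroup.one_eq_mk]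

@[simp]
theorem parent_letter (l : Fin r × Bool) : parent (FreeGroup.mk [l]) = 1 := by
  simp [parent, FreeGroup.toWord_mk, FreeGroup.one_eq_mk]

theorem letter_ne_one (l : Fin r × Bool) : (FreeGroup.mk [l] : FreeGroup (Fin r)) ≠ 1 := by
  intro h
  simpa [FreeGroup.toWord_mk] using congrArg FreeGroup.toWord h

/-- Right multiplication by a letter respects the edges of the tree. -/
theorem parent_mul_letter {g : FreeGroup (Fin r)} (l : Fin r × Bool) (h1 : g ≠ 1)
    (h2 : g ≠ (FreeGroup.mk [l])⁻¹) :
    parent (g * FreeGroup.mk [l]) = parent g * FreeGroup.mk [l] := by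
  have hg : g.toWord ≠ [] := fun h => h1 (FreeGroup.toWord_eq_nil_iff.1 h)
  have hred : FreeGroup.IsReduced g.toWord := FreeGroup.isReduced_toWord
  have hmk : FreeGroup.mk g.toWord = g := FreeGroup.mk_toWord
  rcases List.eq_nil_or_concat g.toWord with h | ⟨w, k, hw⟩
  · exact absurd h hg
  rw [List.concat_eq_append] at hw
  -- Either `l` cancels the last letter of `g`, or it is appended to the reduced word. In both cases
  -- the first letter must survive for the tail to commute with the change; `h2` ensures this in the
  -- cancelling case.
  by_cases hk : k = (l.1, !l.2)
  · have hkl : (FreeGroup.mk [k] : FreeGroup (Fin r)) * FreeGroup.mk [l] = 1 := by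
      rw [hk, FreeGroup.mul_mk]
      have := FreeGroup.Red.Step.not_rev (L₁ := []) (L₂ := []) (x := l.1) (b := l.2)
      exact (FreeGroup.quot_mk_eq_mk ▸ Quot.sound this : _)
    have hw0 : w ≠ [] := by
      rintro rfl
      refine h2 ?_
      rw [← hmk, hw]
      exact eq_inv_of_mul_eq_one_left hkl
    have hgw : g * FreeGroup.mk [l] = FreeGroup.mk w := by
      rw [← hmk, hw, ← FreeGroup.mul_mk, mul_assoc, hkl, mul_one]
    have hwred : FreeGroup.reduce w = w :=
      FreeGroup.IsReduced.reduce_eq (by rw [hw] at hred; exact List.IsChain.left_of_append hred)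
    rw [hgw, parent, parent, FreeGroup.toWord_mk, hwred, hw, List.tail_append_of_ne_nil hw0,
      ← FreeGroup.mul_mk, mul_assoc, hkl, mul_one]
  · have hlred : FreeGroup.IsReduced (g.toWord ++ [l]) := by
      refine List.isChain_append.2 ⟨hred, List.isChain_singleton _, ?_⟩
      intro x hx y hy hxy
      simp only [hw, List.getLast?_append, List.getLast?_singleton, Option.some_or,
        Option.mem_def, Option.some.injEq, List.head?_cons] at hx hy
      subst hx hy
      by_contra hne
      exact hk (Prod.ext hxy (by cases h : k.2 <;> cases h' : l.2 <;> simp_all))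
    have hgl : (g * FreeGroup.mk [l]).toWord = g.toWord ++ [l] := by
      conv_lhs => rw [← hmk, FreeGroup.mul_mk, FreeGroup.toWord_mk]
      exact FreeGroup.IsReduced.reduce_eq hlred
    rw [parent, hgl, List.tail_append_of_ne_nil hg, parent, FreeGroup.mul_mk]

/-- Induction along the tree, from the root outward. -/
theorem tree_induction {p : FreeGroup (Fin r) → Prop} (one : p 1)
    (step : ∀ g, g ≠ 1 → p (parent g) → p g) (g : FreeGroup (Fin r)) : p g := by
  induction hn : g.toWord.length generalizing g with
  | zero =>
    rw [List.length_eq_zero_iff, FreeGroup.toWord_eq_nil_iff] at hn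
    exact hn ▸ one
  | succ n ih =>
    refine step g ?_ (ih _ ?_)
    · rintro rfl
      simp at hn
    · rw [toWord_parent, List.length_tail, hn]
      rfl

/-- A set of vertices which spans a subtree containing the root. -/
def ParentClosed (T : Finset (FreeGroup (Fin r))) : Prop :=
  1 ∈ T ∧ ∀ g ∈ T, parent g ∈ T

/-- Translation preserves edges, so the image is still a subtree; the hypothesis `hl` makes it
contain the root. -/
theorem ParentClosed.image_mul_letter {T : Finset (FreeGroup (Fin r))} (hT : ParentClosed T)
    {l : Fin r × Bool} (hl : (FreeGroup.mk [l])⁻¹ ∈ T) :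
    ParentClosed (T.image (· * FreeGroup.mk [l])) := by
  have h1 : (1 : FreeGroup (Fin r)) ∈ T.image (· * FreeGroup.mk [l]) :=
    Finset.mem_image.2 ⟨_, hl, inv_mul_cancel _⟩
  refine ⟨h1, fun g hg => ?_⟩
  obtain ⟨h, hh, rfl⟩ := Finset.mem_image.1 hg
  by_cases e1 : h = 1
  · simpa [e1] using h1
  by_cases e2 : h = (FreeGroup.mk [l])⁻¹
  · rwa [e2, inv_mul_cancel, parent_one]
  · rw [parent_mul_letter l e1 e2]
    exact Finset.mem_image_of_mem (· * FreeGroup.mk [l]) (hT.2 h hh)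

/-- Parents are obtained by deleting first letters, so it suffices to add all suffixes of the
reduced words in `I`. -/
theorem exists_parentClosed_superset (I : Finset (FreeGroup (Fin r))) :
    ∃ T, I ⊆ T ∧ ParentClosed T := by
  refine ⟨insert 1 (I.biUnion fun g => (g.toWord.tails.map FreeGroup.mk).toFinset), ?_, ?_, ?_⟩
  · intro g hg
    refine Finset.mem_insert_of_mem (Finset.mem_biUnion.2 ⟨g, hg, ?_⟩)
    rw [List.mem_toFinset, List.mem_map]
    exact ⟨g.toWord, (List.mem_tails _ _).2 List.suffix_rfl, FreeGroup.mk_toWord⟩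
  · exact Finset.mem_insert_self _ _
  · intro g hg
    rcases Finset.mem_insert.1 hg with rfl | hg
    · simp
    obtain ⟨k, hk, hg⟩ := Finset.mem_biUnion.1 hg
    rw [List.mem_toFinset, List.mem_map] at hg
    obtain ⟨w, hw, rfl⟩ := hg
    rw [List.mem_tails] at hw
    refine Finset.mem_insert_of_mem (Finset.mem_biUnion.2 ⟨k, hk, ?_⟩)
    rw [List.mem_toFinset, List.mem_map]
    refine ⟨w.tail, (List.mem_tails _ _).2 ((List.tail_suffix w).trans hw), ?_⟩
    have hwr : FreeGroup.reduce w = w :=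
      FreeGroup.IsReduced.reduce_eq (List.IsChain.suffix FreeGroup.isReduced_toWord hw)
    rw [parent, FreeGroup.toWord_mk, hwr]

end Tree

/-! ### Cylinder probabilities -/

section Cylinder

theorem measurableSet_agree {ι A : Type*} [MeasurableSpace A] [MeasurableSingletonClass A]
    (T : Finset ι) (a : ι → A) : MeasurableSet {x : ι → A | ∀ g ∈ T, x g = a g} := by
  have : {x : ι → A | ∀ g ∈ T, x g = a g} = Set.pi (T : Set ι) fun g => {a g} := by
    ext x
    simp [Set.mem_pi]
  rw [this]
  exact MeasurableSet.pi T.countable_toSet fun g _ => measurableSet_singleton _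

/-- Finite measures on `A^ι` are determined by the cylinders over a cofinal family of finite
sets. -/
theorem measure_ext_of_agree {ι A : Type*} [MeasurableSpace A] [MeasurableSingletonClass A]
    [Finite A] [Nonempty A] {μ ν : Measure (ι → A)} [IsFiniteMeasure μ] [IsFiniteMeasure ν]
    (h : ∀ I : Finset ι, ∃ T, I ⊆ T ∧ ∀ a : ι → A,
      μ {x | ∀ g ∈ T, x g = a g} = ν {x | ∀ g ∈ T, x g = a g}) : μ = ν := by
  classical
  -- Both measures are projective limits of the finite marginals of `μ`; a marginal over `I` is an
  -- image of the one over a larger `T`.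
  refine IsProjectiveLimit.unique (P := fun I : Finset ι => μ.map I.restrict)
    (fun I => rfl) (fun I => ?_)
  obtain ⟨T, hIT, hT⟩ := h I
  have hTT : ν.map T.restrict = μ.map T.restrict := by
    refine Measure.ext_of_singleton fun b => ?_
    rw [Measure.map_apply (by fun_prop) (measurableSet_singleton _),
      Measure.map_apply (by fun_prop) (measurableSet_singleton _)]
    have hb : (T.restrict (π := fun _ => A)) ⁻¹' {b} = {x : ι → A | ∀ g ∈ T, x g =
        (fun i => if hi : i ∈ T then b ⟨i, hi⟩ else Classical.arbitrary A) g} := by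
      ext x
      simp only [Set.mem_preimage, Set.mem_singleton_iff, funext_iff, Finset.restrict,
        Subtype.forall, Set.mem_ofPred_eq]
      exact forall₂_congr fun g hg => by rw [dif_pos hg]
    rw [hb, hT]
  have hmap (ρ : Measure (ι → A)) :
      ρ.map I.restrict = (ρ.map T.restrict).map (Finset.restrict₂ (π := fun _ => A) hIT) :=
    (Measure.map_map (μ := ρ) (f := T.restrict (π := fun _ => A))
      (g := Finset.restrict₂ (π := fun _ => A) hIT) (Finset.measurable_restrict₂ hIT)
      (Finset.measurable_restrict T)).symm
  rw [hmap, hTT, ← hmap]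

variable {r : ℕ} {A : Type*}

theorem treeConfig_one (z : A × (FreeGroup (Fin r) × A → A)) : treeConfig z 1 = z.1 := by
  simp [treeConfig, propagate]

theorem treeConfig_of_ne_one (z : A × (FreeGroup (Fin r) × A → A)) {g : FreeGroup (Fin r)}
    (hg : g ≠ 1) : treeConfig z g = z.2 (g, treeConfig z (parent g)) := by
  have h := FreeGroup.mk_toWord (x := g)
  unfold treeConfig
  rw [toWord_parent]
  cases hw : g.toWord with
  | nil => exact absurd (FreeGroup.toWord_eq_nil_iff.1 hw) hg
  | cons l w =>
    rw [hw] at h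
    simp only [propagate, h, List.tail_cons]

/-- On a subtree containing the root, the event fixes the root label and exactly one noise
coordinate `(g, a (parent g))` per other vertex. These coordinates are distinct, so independence
gives the product. -/
theorem treeMarkovChain_agree [MeasurableSpace A] [Finite A] [MeasurableSingletonClass A]
    (π : ProbabilityMeasure A) (P : A → ProbabilityMeasure A)
    {T : Finset (FreeGroup (Fin r))} (hT : ParentClosed T) (a : FreeGroup (Fin r) → A) :
    (treeMarkovChain r π P : Measure (FreeGroup (Fin r) → A)) {x | ∀ g ∈ T, x g = a g} =
      (π : Measure A) {a 1} * ∏ g ∈ T.erase 1, (P (a (parent g)) : Measure A) {a g} := by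
  classical
  have hset : treeConfig ⁻¹' {x : FreeGroup (Fin r) → A | ∀ g ∈ T, x g = a g} =
      ({a 1} : Set A) ×ˢ Set.pi (((T.erase 1).image fun g => (g, a (parent g)) :
        Finset (FreeGroup (Fin r) × A)) : Set (FreeGroup (Fin r) × A)) fun p => {a p.1} := by
    ext z
    simp only [Set.mem_preimage, Set.mem_ofPred_eq, Set.mem_prod, Set.mem_singleton_iff,
      Set.mem_pi, Finset.mem_coe, Finset.mem_image, Finset.mem_erase]
    constructor
    · intro h
      refine ⟨by rw [← treeConfig_one z, h 1 hT.1], ?_⟩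
      rintro _ ⟨g, ⟨hg1, hg⟩, rfl⟩
      rw [← h g hg, treeConfig_of_ne_one z hg1, h _ (hT.2 g hg)]
    · rintro ⟨h1, h⟩ g
      induction g using tree_induction with
      | one => exact fun _ => by rw [treeConfig_one, h1]
      | step g hg ih =>
        intro hgT
        rw [treeConfig_of_ne_one z hg, ih (hT.2 g hgT)]
        exact h _ ⟨g, ⟨hg, hgT⟩, rfl⟩
  change Measure.map _ _ _ = _
  rw [Measure.map_apply measurable_treeConfig (measurableSet_agree T a), hset,
    Measure.prod_prod, Measure.infinitePi_pi _ (fun _ _ => measurableSet_singleton _),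
    Finset.prod_image]
  intro g _ h _ e
  exact (Prod.ext_iff.1 e).1

end Cylinder

/-! ### The free-boundary state -/

section FreeBoundary

variable {r : ℕ} {J : ℝ}

theorem spinLaw_singleton (p : unitInterval) (b : Spin) :
    (spinLaw p : Measure Spin) {b} = ENNReal.ofReal (if b then 1 - (p : ℝ) else p) := by
  change (ENNReal.ofReal (p : ℝ) • Measure.dirac false +
    ENNReal.ofReal (1 - (p : ℝ)) • Measure.dirac true : Measure Spin) {b} = _
  cases b <;> simp

theorem isingAlpha_zero (J : ℝ) : (isingAlpha J 0 : ℝ) = 1 / 2 := by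
  have h := Real.exp_pos (-2 * J)
  simp only [isingAlpha, mul_zero, Real.exp_zero, Real.cosh_zero]
  rw [div_eq_div_iff (by positivity) (by norm_num)]
  ring

/-- The transition probabilities of the free-boundary state. -/
def edgeWeight (J : ℝ) (a b : Spin) : ℝ :=
  if a = b then 1 - (isingBeta J 0 : ℝ) else isingBeta J 0

theorem edgeWeight_comm (J : ℝ) (a b : Spin) : edgeWeight J a b = edgeWeight J b a := by
  simp only [edgeWeight, eq_comm]

theorem edgeWeight_nonneg (J : ℝ) (a b : Spin) : 0 ≤ edgeWeight J a b := by
  have h := (isingBeta J 0).2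
  unfold edgeWeight
  split_ifs <;> linarith [h.1, h.2]

/-- The root factor does not depend on `a`, and `edgeWeight` is symmetric, so the right side sees
only unoriented edges. This is what makes the state independent of the root. -/
theorem freeBoundaryState_agree {T : Finset (FreeGroup (Fin r))} (hT : ParentClosed T)
    (a : FreeGroup (Fin r) → Spin) :
    (freeBoundaryState r J : Measure (FreeGroup (Fin r) → Spin)) {x | ∀ g ∈ T, x g = a g} =
      ENNReal.ofReal (1 / 2) *
        ∏ g ∈ T.erase 1, ENNReal.ofReal (edgeWeight J (a (parent g)) (a g)) := by
  rw [freeBoundaryState, isingChain, treeMarkovChain_agree _ _ hT, spinLaw_singleton,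
    isingAlpha_zero]
  congr 1
  · cases a 1 <;> norm_num
  · refine Finset.prod_congr rfl fun g _ => ?_
    cases a (parent g) <;> cases a g <;> simp [spinLaw_singleton, edgeWeight]

theorem measurable_shift {Γ A : Type*} [Group Γ] [MeasurableSpace A] (g : Γ) :
    Measurable (shift g : (Γ → A) → Γ → A) :=
  measurable_pi_lambda _ fun h => measurable_pi_apply (h * g)

/-- The shift turns a cylinder over T into one over Ts. The edges correspond, and only the edge
{s⁻¹, 1}, which becomes {1, s}, changes its orientation towards the root. -/
theorem shift_letter_measurePreserving (l : Fin r × Bool) :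
    MeasurePreserving (shift (FreeGroup.mk [l]))
      (freeBoundaryState r J : Measure (FreeGroup (Fin r) → Spin))
      (freeBoundaryState r J : Measure (FreeGroup (Fin r) → Spin)) := by
  refine ⟨measurable_shift _, ?_⟩
  obtain ⟨s, hs⟩ : ∃ s : FreeGroup (Fin r), s = FreeGroup.mk [l] := ⟨_, rfl⟩
  have hs1 : s ≠ 1 := hs ▸ letter_ne_one l
  have hps : parent s = 1 := hs ▸ parent_letter l
  have hps' : parent s⁻¹ = 1 := by
    rw [hs, FreeGroup.inv_mk]
    exact parent_letter _
  have hpm : ∀ {g : FreeGroup (Fin r)}, g ≠ 1 → g ≠ s⁻¹ → parent (g * s) = parent g * s := by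
    subst hs
    exact fun h1 h2 => parent_mul_letter l h1 h2
  rw [← hs]
  have := Measure.isProbabilityMeasure_map
    (μ := (freeBoundaryState r J : Measure (FreeGroup (Fin r) → Spin)))
    (measurable_shift s).aemeasurable
  refine measure_ext_of_agree fun I => ?_
  obtain ⟨T, hIT, hT⟩ := exists_parentClosed_superset (insert s⁻¹ I)
  have hsT : s⁻¹ ∈ T := hIT (Finset.mem_insert_self _ _)
  refine ⟨T, (Finset.subset_insert _ _).trans hIT, fun a => ?_⟩
  have hset : shift s ⁻¹' {x : FreeGroup (Fin r) → Spin | ∀ g ∈ T, x g = a g} =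
      {x | ∀ g ∈ T.image (· * s), x g = a (g * s⁻¹)} := by
    ext x
    simp only [shift, Set.mem_preimage, Set.mem_ofPred_eq, Finset.forall_mem_image,
      mul_inv_cancel_right]
  have hT' : ParentClosed (T.image (· * s)) := by
    subst hs
    exact hT.image_mul_letter hsT
  rw [Measure.map_apply (measurable_shift s) (measurableSet_agree T a), hset,
    freeBoundaryState_agree hT', freeBoundaryState_agree hT]
  congr 1
  symm
  -- Non-root vertices index edges. Since s⁻¹ is translated to the root, its edge is reassigned to
  -- s, the translate of the old root.
  refine Finset.prod_bij (fun g _ => if g = s⁻¹ then s else g * s) ?_ ?_ ?_ ?_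
  · intro g hg
    rw [Finset.mem_erase] at hg
    rw [Finset.mem_erase]
    split_ifs with h
    · exact ⟨hs1, Finset.mem_image.2 ⟨1, hT.1, one_mul s⟩⟩
    · exact ⟨fun h' => h (eq_inv_of_mul_eq_one_left h'), Finset.mem_image_of_mem (· * s) hg.2⟩
  · intro g hg h hh e
    rw [Finset.mem_erase] at hg hh
    split_ifs at e with e1 e2 e2
    · rw [e1, e2]
    · exact absurd (right_eq_mul.1 e) hh.1
    · exact absurd (mul_eq_right.1 e) hg.1
    · exact mul_right_cancel e
  · intro k hk
    obtain ⟨hk1, hk⟩ := Finset.mem_erase.1 hk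
    obtain ⟨g, hg, rfl⟩ := Finset.mem_image.1 hk
    by_cases hg1 : g = 1
    · refine ⟨s⁻¹, Finset.mem_erase.2 ⟨inv_ne_one.2 hs1, hsT⟩, ?_⟩
      simp [hg1]
    · refine ⟨g, Finset.mem_erase.2 ⟨hg1, hg⟩, ?_⟩
      rw [if_neg]
      rintro rfl
      simp at hk1
  · intro g hg
    obtain ⟨hg1, hg⟩ := Finset.mem_erase.1 hg
    split_ifs with h
    · rw [h, hps, hps', edgeWeight_comm, mul_inv_cancel, one_mul]
    · rw [hpm hg1 h, mul_inv_cancel_right, mul_inv_cancel_right]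

theorem freeBoundaryState_shiftInvariant : ShiftInvariant (freeBoundaryState r J) := by
  intro g
  rw [← FreeGroup.mk_toWord (x := g)]
  induction g.toWord with
  | nil =>
    convert MeasurePreserving.id _ using 1
    ext x h
    simp [shift, ← FreeGroup.one_eq_mk]
  | cons l w ih =>
    convert (shift_letter_measurePreserving l).comp ih using 1
    ext x h
    simp only [shift, Function.comp_apply, mul_assoc, FreeGroup.mul_mk, List.singleton_append]

theorem freeBoundaryState_ne (l : Fin r × Bool) :
    (freeBoundaryState r J : Measure (FreeGroup (Fin r) → Spin))
      {x | x 1 ≠ x (FreeGroup.mk [l])} = ENNReal.ofReal (isingBeta J 0) := by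
  set s : FreeGroup (Fin r) := FreeGroup.mk [l] with hs
  have hs1 : s ≠ 1 := letter_ne_one l
  have hT : ParentClosed {1, s} := by simp [ParentClosed, hs]
  have hset : {x : FreeGroup (Fin r) → Spin | x 1 ≠ x s} =
      {x | ∀ g ∈ ({1, s} : Finset (FreeGroup (Fin r))), x g = decide (g = 1)} ∪
      {x | ∀ g ∈ ({1, s} : Finset (FreeGroup (Fin r))), x g = decide (g ≠ 1)} := by
    ext x
    simp only [Set.mem_ofPred_eq, Set.mem_union, Finset.mem_insert, Finset.mem_singleton,
      forall_eq_or_imp, forall_eq, hs1]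
    cases x 1 <;> cases x s <;> simp [hs1]
  have hdisj : Disjoint
      {x : FreeGroup (Fin r) → Spin |
        ∀ g ∈ ({1, s} : Finset (FreeGroup (Fin r))), x g = decide (g = 1)}
      {x | ∀ g ∈ ({1, s} : Finset (FreeGroup (Fin r))), x g = decide (g ≠ 1)} := by
    rw [Set.disjoint_left]
    intro x hx hx'
    have h1 := hx 1 (by simp)
    have h2 := hx' 1 (by simp)
    simp [h1] at h2
  have herase : ({1, s} : Finset (FreeGroup (Fin r))).erase 1 = {s} := by
    ext g
    simp only [Finset.mem_erase, Finset.mem_insert, Finset.mem_singleton]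
    exact ⟨fun h => h.2.resolve_left h.1, fun h => ⟨h ▸ hs1, Or.inr h⟩⟩
  rw [hset, measure_union hdisj (measurableSet_agree _ _), freeBoundaryState_agree hT,
    freeBoundaryState_agree hT, herase, Finset.prod_singleton, Finset.prod_singleton,
    ← ENNReal.ofReal_mul (by norm_num), ← ENNReal.ofReal_mul (by norm_num),
    ← ENNReal.ofReal_add (mul_nonneg (by norm_num) (edgeWeight_nonneg ..))
      (mul_nonneg (by norm_num) (edgeWeight_nonneg ..))]
  congr 1
  have hp : parent s = 1 := parent_letter l
  simp [hp, hs1, edgeWeight]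
  ring

end FreeBoundary

/-! ### Counting spin configurations with few flips along a permutation -/

section Counting

variable {V : Type*} [Fintype V]

/-- A permutation with few short cycles has few cycles. -/
theorem mul_card_cycles_le (τ : Equiv.Perm V) (K : ℕ) :
    K * Nat.card (Quotient (Equiv.Perm.SameCycle.setoid τ)) ≤
      Fintype.card V + K * {v : V | ∃ k, 1 ≤ k ∧ k < K ∧ (τ ^ k) v = v}.ncard := by
  classical
  set Q := Quotient (Equiv.Perm.SameCycle.setoid τ)
  set B : Set V := {v : V | ∃ k, 1 ≤ k ∧ k < K ∧ (τ ^ k) v = v}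
  have hout : ∀ q : Q, (Quotient.mk _ q.out : Q) = q := Quotient.out_eq
  -- Cycles are split by whether their chosen representative lies on a cycle shorter than `K`.
  have hshort : Nat.card {q : Q // q.out ∈ B} ≤ B.ncard := by
    refine Nat.card_le_card_of_injective (fun q : {q : Q // q.out ∈ B} => (⟨q.1.out, q.2⟩ : B)) ?_
    intro q q' h
    refine Subtype.ext ?_
    rw [← hout q.1, ← hout q'.1, Subtype.mk.inj h]
  -- The first `K` iterates of a representative outside `B` are distinct, and different cycles are
  -- disjoint.
  have hlong : Nat.card {q : Q // q.out ∉ B} * K ≤ Fintype.card V := by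
    have h := Nat.card_le_card_of_injective
      (fun p : {q : Q // q.out ∉ B} × Fin K => (τ ^ (p.2 : ℕ)) p.1.1.out) ?_
    · simpa [Nat.card_prod] using h
    rintro ⟨⟨q, hq⟩, i⟩ ⟨⟨q', hq'⟩, j⟩ h
    simp only at h
    have hqq : q = q' := by
      rw [← hout q, ← hout q']
      refine Quotient.sound ?_
      have : τ.SameCycle ((τ ^ (i : ℕ)) q.out) ((τ ^ (j : ℕ)) q'.out) := h ▸ .refl _ _
      exact Equiv.Perm.sameCycle_pow_left.1 (Equiv.Perm.sameCycle_pow_right.1 this)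
    subst hqq
    have hlt : ∀ i j : ℕ, i < j → j < K → (τ ^ i) q.out ≠ (τ ^ j) q.out := by
      intro i j hij hj h
      refine hq ⟨j - i, by omega, by omega, (τ ^ i).injective ?_⟩
      rw [← Equiv.Perm.mul_apply, ← pow_add, Nat.add_sub_cancel' hij.le, h]
    have hij : (i : ℕ) = j := by
      rcases lt_trichotomy (i : ℕ) j with h' | h' | h'
      · exact absurd h (hlt _ _ h' j.2)
      · exact h'
      · exact absurd h.symm (hlt _ _ h' i.2)
    simp [Fin.ext hij]
  have hsum : Nat.card Q = Nat.card {q : Q // q.out ∈ B} + Nat.card {q : Q // q.out ∉ B} := by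
    rw [← Nat.card_sum]
    exact Nat.card_congr (Equiv.sumCompl _).symm
  rw [hsum, Nat.mul_add]
  have := Nat.mul_le_mul_left K hshort
  linarith [mul_comm K (Nat.card {q : Q // q.out ∉ B})]

/-- A configuration is determined by its flips along a permutation and its value at one point of
each cycle. -/
theorem ncard_flips_le (τ : Equiv.Perm V) (p : Set V → Prop) :
    {x : V → Bool | p {v | x v ≠ x (τ v)}}.ncard ≤
      {D : Set V | p D}.ncard * 2 ^ Nat.card (Quotient (Equiv.Perm.SameCycle.setoid τ)) := by
  classical
  set Q := Quotient (Equiv.Perm.SameCycle.setoid τ)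
  have hout : ∀ q : Q, (Quotient.mk _ q.out : Q) = q := Quotient.out_eq
  have h := Nat.card_le_card_of_injective
    (fun x : {x : V → Bool | p {v | x v ≠ x (τ v)}} =>
      ((⟨{v | x.1 v ≠ x.1 (τ v)}, x.2⟩ : {D : Set V | p D}), fun q : Q => x.1 q.out)) ?_
  · rw [Nat.card_prod, Nat.card_fun, Nat.card_eq_fintype_card (α := Bool), Fintype.card_bool] at h
    exact h
  rintro ⟨x, hx⟩ ⟨y, hy⟩ h
  obtain ⟨hD, hQ⟩ := Prod.mk.inj h
  have hD : ∀ v, x v ≠ x (τ v) ↔ y v ≠ y (τ v) := Set.ext_iff.1 (Subtype.mk.inj hD)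
  -- With two spin values and equal flip sets, agreement of `x` and `y` passes along `τ` in both
  -- directions.
  have hstep : ∀ v, x v = y v ↔ x (τ v) = y (τ v) := by
    intro v
    have := hD v
    revert this
    cases x v <;> cases y v <;> cases x (τ v) <;> cases y (τ v) <;> simp
  have hpow : ∀ (n : ℕ) v, x v = y v ↔ x ((τ ^ n) v) = y ((τ ^ n) v) := by
    intro n v
    induction n with
    | zero => rfl
    | succ n ih => rw [ih, hstep, pow_succ', Equiv.Perm.mul_apply]
  refine Subtype.ext (funext fun v => ?_)
  have hv : τ.SameCycle (Quotient.mk _ v : Q).out v := Quotient.exact (hout _)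
  obtain ⟨n, hn⟩ := hv.exists_nat_pow_eq
  have := (hpow n _).1 (congrFun hQ (Quotient.mk _ v))
  rwa [hn] at this

/-- Chernoff's bound for the number of small subsets. -/
theorem ncard_small_sets_le {a : ℝ} (ha : 0 ≤ a) (m : ℝ) :
    ({D : Set V | (D.ncard : ℝ) ≤ m}.ncard : ℝ) ≤
      Real.exp (a * m + Fintype.card V * Real.log (1 + Real.exp (-a))) := by
  classical
  have hpos := Real.exp_pos (-a)
  have hcard : {D : Set V | (D.ncard : ℝ) ≤ m}.ncard =
      (Finset.univ.filter fun D : Finset V => (D.card : ℝ) ≤ m).card := by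
    rw [← Set.ncard_coe_finset, ← Set.ncard_image_of_injective _ (Finset.coe_injective (α := V))]
    congr 1
    ext D
    simp only [Set.mem_ofPred_eq, Set.mem_image, Finset.coe_filter, Finset.mem_univ, true_and]
    constructor
    · intro h
      exact ⟨D.toFinset, by rwa [← Set.ncard_eq_toFinset_card'], by simp⟩
    · rintro ⟨D, h, rfl⟩
      rwa [Set.ncard_coe_finset]
  have hsum := Finset.sum_pow_mul_eq_add_pow (Real.exp (-a)) 1 (Finset.univ : Finset V)
  simp only [Finset.powerset_univ, one_pow, mul_one, Finset.card_univ] at hsum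
  -- Each `D` with at most `m` points contributes at least e^{-am} to the binomial expansion of
  -- (e^{-a}+1)^{|V|}.
  have hlow : ((Finset.univ.filter fun D : Finset V => (D.card : ℝ) ≤ m).card : ℝ) *
      Real.exp (-(a * m)) ≤ (Real.exp (-a) + 1) ^ Fintype.card V := by
    rw [← hsum, ← nsmul_eq_mul]
    refine (Finset.card_nsmul_le_sum _ (fun D : Finset V => Real.exp (-a) ^ D.card) _ ?_).trans
      (Finset.sum_le_sum_of_subset_of_nonneg (Finset.filter_subset _ _) fun _ _ _ => by positivity)
    intro D hD
    rw [← Real.exp_nat_mul, Real.exp_le_exp]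
    have := mul_le_mul_of_nonneg_left (Finset.mem_filter.1 hD).2 ha
    linarith
  have hpow : Real.exp (Fintype.card V * Real.log (1 + Real.exp (-a))) =
      (Real.exp (-a) + 1) ^ Fintype.card V := by
    rw [Real.exp_nat_mul, Real.exp_log (by positivity), add_comm]
  rw [hcard, Real.exp_add, hpow]
  have h := mul_le_mul_of_nonneg_left hlow (Real.exp_pos (a * m)).le
  rw [mul_left_comm, ← Real.exp_add, add_neg_cancel, Real.exp_zero, mul_one] at h
  exact h

end Counting

/-! ### Sofic entropy and the rate of flips along a generator -/

theorem empirical_apply {Γ V A : Type*} [Fintype V] [Nonempty V] [MeasurableSpace A]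
    (σ : Γ → Equiv.Perm V) (x : V → A) {C : Set (Γ → A)} (hC : MeasurableSet C) :
    (empirical σ x : Measure (Γ → A)) C =
      ({v | pullbackName σ x v ∈ C}.ncard : ℝ≥0∞) / Fintype.card V := by
  classical
  change ((Fintype.card V : ℝ≥0∞)⁻¹ • ∑ v : V, Measure.dirac (pullbackName σ x v)) C = _
  rw [Measure.smul_apply, Measure.finsetSum_apply, smul_eq_mul, ENNReal.div_eq_inv_mul]
  congr 1
  simp_rw [Measure.dirac_apply' _ hC, Set.indicator_apply, Pi.one_apply]
  rw [Finset.sum_boole, ← Set.ncard_coe_finset]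
  simp

section Entropy

variable {Γ : Type*} [Group Γ]

theorem ncard_compl_le_of_lt_div {V : Type*} [Fintype V] [Nonempty V] {δ : ℝ} {s : Set V}
    (h : 1 - δ < (s.ncard : ℝ) / Fintype.card V) : (sᶜ.ncard : ℝ) ≤ δ * Fintype.card V := by
  have hN : (0 : ℝ) < Fintype.card V := by exact_mod_cast Fintype.card_pos
  have hs : (s.ncard : ℝ) + sᶜ.ncard = Fintype.card V := by
    rw [← Nat.card_eq_fintype_card]
    exact_mod_cast Set.ncard_add_ncard_compl s
  rw [lt_div_iff₀ hN] at h
  linarith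

/-- The powers `s ^ k`, `k ≤ K`. -/
def powersUpTo (s : Γ) (K : ℕ) : Finset Γ :=
  haveI := Classical.decEq Γ
  (Finset.range (K + 1)).image (s ^ ·)

theorem pow_mem_powersUpTo (s : Γ) {k K : ℕ} (h : k ≤ K) : s ^ k ∈ powersUpTo s K := by
  classical
  exact Finset.mem_image.2 ⟨k, Finset.mem_range.2 (by omega), rfl⟩

theorem apply_one_eq_of_forall_mul {V : Type*} {σ : Γ → Equiv.Perm V} {F : Finset Γ} (hF : 1 ∈ F)
    {v : V} (hv : ∀ γ₁ ∈ F, ∀ γ₂ ∈ F, σ (γ₁ * γ₂) v = σ γ₁ (σ γ₂ v)) : σ 1 v = v := by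
  have h := hv 1 hF 1 hF
  rw [mul_one] at h
  exact ((σ 1).injective h).symm

section SoficMap

variable {V : Type*} [Fintype V] [Nonempty V] {σ : Γ → Equiv.Perm V} {s : Γ} {K : ℕ} {δ : ℝ}

theorem IsSoficMap.ncard_apply_one_ne_le (h : IsSoficMap σ (powersUpTo s K) δ) :
    ({v : V | σ 1 v ≠ v}.ncard : ℝ) ≤ δ * Fintype.card V := by
  refine le_trans ?_ (ncard_compl_le_of_lt_div h.2)
  refine Nat.cast_le.2 (Set.ncard_le_ncard (fun v hv hgood => hv ?_) (Set.toFinite _))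
  exact apply_one_eq_of_forall_mul (pow_zero s ▸ pow_mem_powersUpTo s (Nat.zero_le K)) hgood

/-- Off the two exceptional sets, each of proportion at most δ, one has σ(s)^k v = σ(s^k) v ≠ v for
1 ≤ k < K. -/
theorem IsSoficMap.ncard_short_cycles_le (h : IsSoficMap σ (powersUpTo s K) δ)
    (hs : ∀ k, 1 ≤ k → s ^ k ≠ 1) :
    ({v : V | ∃ k, 1 ≤ k ∧ k < K ∧ (σ s ^ k) v = v}.ncard : ℝ) ≤ 2 * δ * Fintype.card V := by
  have h1 := ncard_compl_le_of_lt_div h.1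
  have h2 := ncard_compl_le_of_lt_div h.2
  have hsub : {v : V | ∃ k, 1 ≤ k ∧ k < K ∧ (σ s ^ k) v = v} ⊆
      {v : V | ∀ γ ∈ powersUpTo s K, γ ≠ 1 → σ γ v ≠ v}ᶜ ∪
      {v : V | ∀ γ₁ ∈ powersUpTo s K, ∀ γ₂ ∈ powersUpTo s K,
        σ (γ₁ * γ₂) v = σ γ₁ (σ γ₂ v)}ᶜ := by
    rintro v ⟨k, hk1, hkK, hk⟩
    by_contra hv
    rw [Set.mem_union, not_or, Set.notMem_compl_iff, Set.notMem_compl_iff] at hv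
    obtain ⟨hfree, hact⟩ := hv
    have hpow : ∀ j ≤ K, σ (s ^ j) v = (σ s ^ j) v := by
      intro j hj
      induction j with
      | zero =>
        simpa using apply_one_eq_of_forall_mul (pow_zero s ▸ pow_mem_powersUpTo s (Nat.zero_le K)) hact
      | succ j ih =>
        rw [pow_succ', pow_succ', Equiv.Perm.mul_apply, ← ih (by omega)]
        exact hact s (by simpa using pow_mem_powersUpTo s (k := 1) (K := K) (by omega)) _
          (pow_mem_powersUpTo s (by omega))
    exact hfree _ (pow_mem_powersUpTo s hkK.le) (hs k hk1) ((hpow k hkK.le).trans hk)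
  have h3 := (Set.ncard_le_ncard hsub (Set.toFinite _)).trans (Set.ncard_union_le _ _)
  have h4 : ({v : V | ∃ k, 1 ≤ k ∧ k < K ∧ (σ s ^ k) v = v}.ncard : ℝ) ≤ _ := Nat.cast_le.2 h3
  rw [Nat.cast_add] at h4
  linarith

/-- Few configurations flip along `s` with frequency less than `b`. -/
theorem IsSoficMap.ncard_models_le (h : IsSoficMap σ (powersUpTo s K) δ)
    (hs : ∀ k, 1 ≤ k → s ^ k ≠ 1) (hK : 0 < K) {a b : ℝ} (ha : 0 ≤ a) (hb : 0 ≤ b)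
    {O : Set (ProbabilityMeasure (Γ → Bool))}
    (hO : ∀ ν ∈ O, (ν : Measure (Γ → Bool)) {x | x 1 ≠ x s} ≤ ENNReal.ofReal b) :
    ((models σ O).ncard : ℝ) ≤
      Real.exp (Fintype.card V * (a * (b + δ) + Real.log (1 + Real.exp (-a)) + (1 / K + 2 * δ))) := by
  have hN : (0 : ℝ) < Fintype.card V := by exact_mod_cast Fintype.card_pos
  have hC : MeasurableSet {x : Γ → Bool | x 1 ≠ x s} :=
    (measurableSet_eq_fun (measurable_pi_apply 1) (measurable_pi_apply s)).compl
  have hsub : models σ O ⊆ {x : V → Bool |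
      ({v | x v ≠ x (σ s v)}.ncard : ℝ) ≤ (b + δ) * Fintype.card V} := by
    intro x hx
    have h1 := hO _ hx
    rw [empirical_apply σ x hC] at h1
    have h2 : ({v | pullbackName σ x v ∈ {x : Γ → Bool | x 1 ≠ x s}}.ncard : ℝ) ≤
        b * Fintype.card V := by
      rw [ENNReal.div_le_iff (by simp) (by simp), ← ENNReal.ofReal_natCast, ← ENNReal.ofReal_natCast,
        ← ENNReal.ofReal_mul hb, ENNReal.ofReal_le_ofReal_iff (by positivity)] at h1
      exact h1
    -- Pullback names read `x (σ 1 v)` rather than `x v`; as `σ 1` need not be the identity, this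
    -- costs the extra δ in the flip frequency.
    have h3 : {v | x v ≠ x (σ s v)} ⊆
        {v | pullbackName σ x v ∈ {x : Γ → Bool | x 1 ≠ x s}} ∪ {v | σ 1 v ≠ v} := by
      intro v hv
      by_cases h1 : σ 1 v = v
      · left
        simpa [pullbackName, h1] using hv
      · exact Or.inr h1
    have h4 : ({v | x v ≠ x (σ s v)}.ncard : ℝ) ≤ _ :=
      Nat.cast_le.2 ((Set.ncard_le_ncard h3 (Set.toFinite _)).trans (Set.ncard_union_le _ _))
    rw [Nat.cast_add] at h4
    have h5 := h.ncard_apply_one_ne_le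
    change ({v | x v ≠ x (σ s v)}.ncard : ℝ) ≤ _
    linarith
  have hcycles : (Nat.card (Quotient (Equiv.Perm.SameCycle.setoid (σ s))) : ℝ) ≤
      Fintype.card V * (1 / K + 2 * δ) := by
    have h1 := Nat.cast_le (α := ℝ).2 (mul_card_cycles_le (σ s) K)
    have h2 := h.ncard_short_cycles_le hs
    have hK' : (0 : ℝ) < K := Nat.cast_pos.2 hK
    rw [Nat.cast_add, Nat.cast_mul, Nat.cast_mul] at h1
    have h3 := mul_le_mul_of_nonneg_left h2 hK'.le
    refine le_of_mul_le_mul_left ?_ hK'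
    have : (K : ℝ) * (Fintype.card V * (1 / K + 2 * δ)) =
        Fintype.card V + K * (2 * δ * Fintype.card V) := by
      field_simp
    linarith
  have h1 := (Set.ncard_le_ncard hsub (Set.toFinite _)).trans 
    (ncard_flips_le (σ s) fun D => (D.ncard : ℝ) ≤ (b + δ) * Fintype.card V)
  have h2 : ((models σ O).ncard : ℝ) ≤ _ := Nat.cast_le.2 h1
  rw [Nat.cast_mul, Nat.cast_pow, Nat.cast_ofNat] at h2
  refine h2.trans ?_
  have h3 := ncard_small_sets_le (V := V) ha ((b + δ) * Fintype.card V)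
  have h4 : (2 : ℝ) ^ Nat.card (Quotient (Equiv.Perm.SameCycle.setoid (σ s))) ≤
      Real.exp (Fintype.card V * (1 / K + 2 * δ)) := by
    have h2e : (2 : ℝ) ≤ Real.exp 1 := by
      have := Real.add_one_le_exp (1 : ℝ)
      linarith
    refine (pow_le_pow_left₀ (by norm_num) h2e _).trans ?_
    rw [← Real.exp_nat_mul, mul_one]
    exact Real.exp_le_exp.2 hcycles
  refine (mul_le_mul h3 h4 (by positivity) (Real.exp_pos _).le).trans (le_of_eq ?_)
  rw [← Real.exp_add]
  ring_nf

end SoficMap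

/-- The event depends on two discrete coordinates, so it is clopen and its mass is weakly
continuous. -/
theorem isOpen_flip_lt [Countable Γ] (s : Γ) (c : ℝ≥0∞) :
    IsOpen {ν : ProbabilityMeasure (Γ → Bool) |
      (ν : Measure (Γ → Bool)) {x | x 1 ≠ x s} < c} := by
  have hclopen : IsClopen {x : Γ → Bool | x 1 ≠ x s} := by
    have : IsClopen {p : Bool × Bool | p.1 ≠ p.2} := isClopen_discrete _
    exact this.preimage (f := fun x : Γ → Bool => (x 1, x s)) (by fun_prop)
  refine isOpen_lt (continuous_iff_continuousAt.2 fun ν => ?_) continuous_const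
  refine ProbabilityMeasure.tendsto_measure_of_null_frontier_of_tendsto' tendsto_id ?_
  rw [hclopen.frontier_eq]
  exact measure_empty

theorem log_div_le_of_le_exp {n N : ℕ} (hN : 0 < N) {c : ℝ} (h : (n : ℝ) ≤ Real.exp (N * c)) :
    ENNReal.log (n : ℝ≥0∞) / (N : EReal) ≤ (c : EReal) := by
  have hN' : (0 : EReal) < N := by exact_mod_cast hN
  rw [EReal.div_le_iff_le_mul hN' (EReal.natCast_ne_top N)]
  have h1 : (n : ℝ≥0∞) ≤ ENNReal.ofReal (Real.exp (N * c)) := by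
    rw [← ENNReal.ofReal_natCast]
    exact ENNReal.ofReal_le_ofReal h
  have h2 := ENNReal.log_le_log h1
  rw [ENNReal.log_ofReal_of_pos (Real.exp_pos _), Real.log_exp, EReal.coe_mul] at h2
  exact h2

/-- The sofic entropy of a measure is at most the growth rate of the number of configurations with
its frequency of flips along an element `s` of infinite order. -/
theorem soficEntropy_le_of_flip_lt [Countable Γ] {V : ℕ → Type*} [∀ n, Fintype (V n)]
    [∀ n, Nonempty (V n)] {σ : ∀ n, Γ → Equiv.Perm (V n)} (hσ : IsSoficApproximation σ) {s : Γ}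
    (hs : ∀ k, 1 ≤ k → s ^ k ≠ 1) {μ : ProbabilityMeasure (Γ → Bool)} {a b c : ℝ} (ha : 0 ≤ a)
    (hb : 0 ≤ b) (hμ : (μ : Measure (Γ → Bool)) {x | x 1 ≠ x s} < ENNReal.ofReal b)
    (hc : a * b + Real.log (1 + Real.exp (-a)) < c) :
    soficEntropy σ μ ≤ (c : EReal) := by
  set ε := c - (a * b + Real.log (1 + Real.exp (-a)))
  have hε0 : 0 < ε := sub_pos.2 hc
  -- The error in `IsSoficMap.ncard_models_le` is 1/K + (a+2)δ; each summand gets half of the slack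
  -- ε.
  obtain ⟨K, hK⟩ := exists_nat_gt (2 / ε)
  have hK0 : (0 : ℝ) < K := (by positivity : (0 : ℝ) < 2 / ε).trans hK
  have hKε : 1 / (K : ℝ) ≤ ε / 2 := by
    rw [div_lt_iff₀ hε0] at hK
    rw [div_le_div_iff₀ hK0 two_pos]
    linarith
  have hδ : 0 < ε / (2 * (a + 2)) := by positivity
  have hδε : (a + 2) * (ε / (2 * (a + 2))) = ε / 2 := by field_simp
  set δ := ε / (2 * (a + 2))
  refine (iInf₂_le _ (isOpen_flip_lt s (ENNReal.ofReal b))).trans ((iInf_le _ hμ).trans ?_)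
  refine limsup_le_of_le (by isBoundedDefault) ?_
  filter_upwards [hσ.2 (powersUpTo s K) δ hδ] with n hn
  refine log_div_le_of_le_exp Fintype.card_pos ?_
  refine (hn.ncard_models_le hs (Nat.cast_pos.1 hK0) ha hb fun ν hν => le_of_lt hν).trans ?_
  rw [Real.exp_le_exp]
  refine mul_le_mul_of_nonneg_left ?_ (Nat.cast_nonneg _)
  linarith

end Entropy

/-! ### The all-plus state -/

section Plus

/-- The point mass at the configuration all of whose spins are `+1`. -/
def plusState (Γ : Type*) : ProbabilityMeasure (Γ → Spin) :=
  ⟨Measure.dirac fun _ => true, inferInstance⟩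

theorem plusState_shiftInvariant (Γ : Type*) [Group Γ] : ShiftInvariant (plusState Γ) := by
  intro g
  refine ⟨measurable_shift g, ?_⟩
  exact Measure.map_dirac' (measurable_shift g) fun _ => true

theorem empirical_plus {Γ V : Type*} [Fintype V] [Nonempty V] (σ : Γ → Equiv.Perm V) :
    empirical σ (fun _ : V => true) = plusState Γ := by
  refine Subtype.ext ?_
  change (Fintype.card V : ℝ≥0∞)⁻¹ • ∑ v : V, Measure.dirac (pullbackName σ (fun _ => true) v) =
    Measure.dirac fun _ => true
  have : ∀ v : V, pullbackName σ (fun _ => true) v = fun _ => true := fun v => rfl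
  simp only [this, Finset.sum_const, Finset.card_univ]
  rw [← Nat.cast_smul_eq_nsmul ℝ≥0∞, smul_smul, ENNReal.inv_mul_cancel (by simp) (by simp),
    one_smul]

/-- The constant configuration has this state as its exact empirical measure for every `σ`, so each
neighbourhood has at least one model. -/
theorem soficEntropy_plusState_nonneg {Γ : Type*} [Group Γ] [Countable Γ] {V : ℕ → Type*}
    [∀ n, Fintype (V n)] [∀ n, Nonempty (V n)] (σ : ∀ n, Γ → Equiv.Perm (V n)) :
    0 ≤ soficEntropy σ (plusState Γ) := by
  refine le_iInf fun O => le_iInf fun _ => le_iInf fun hO => ?_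
  refine le_limsup_of_frequently_le (Frequently.of_forall fun n => ?_) (by isBoundedDefault)
  refine EReal.div_nonneg (ENNReal.zero_le_log_iff.2 ?_) (by exact_mod_cast Nat.zero_le _)
  have hmem : (fun _ => true) ∈ models (σ n) O := by
    change empirical _ _ ∈ O
    rwa [empirical_plus]
  have : 1 ≤ (models (σ n) O).ncard := (Set.ncard_pos (Set.toFinite _)).2 ⟨_, hmem⟩
  exact_mod_cast this

theorem integral_isingEnergy_plusState (r : ℕ) (J : ℝ) :
    ∫ x, isingEnergy r J x ∂(plusState (FreeGroup (Fin r)) : Measure _) = -(r * J) := by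
  change ∫ x, isingEnergy r J x ∂(Measure.dirac _) = _
  rw [integral_dirac]
  simp only [isingEnergy, Spin.val, if_true, mul_one, Finset.sum_const, Finset.card_univ,
    Fintype.card_fin, nsmul_eq_mul]
  ring

theorem le_pressure_plusState {r : ℕ} (J : ℝ) {V : ℕ → Type*} [∀ n, Fintype (V n)]
    [∀ n, Nonempty (V n)] (σ : ∀ n, FreeGroup (Fin r) → Equiv.Perm (V n)) :
    ((r * J : ℝ) : EReal) ≤ pressure σ (isingEnergy r J) (plusState _) := by
  rw [pressure, integral_isingEnergy_plusState]
  have := EReal.sub_le_sub (soficEntropy_plusState_nonneg σ) (le_refl ((-(r * J) : ℝ) : EReal))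
  refine le_trans (le_of_eq ?_) this
  rw [zero_sub, ← EReal.coe_neg, neg_neg]

end Plus

/-! ### The pressure of the free-boundary state -/

section FreeBoundaryPressure

variable {r : ℕ}

theorem integral_spin_mul_spin {Γ : Type*} [Countable Γ] (μ : ProbabilityMeasure (Γ → Spin))
    (g h : Γ) : Integrable (fun x : Γ → Spin => (x g).val * (x h).val) (μ : Measure (Γ → Spin)) ∧
      ∫ x, (x g).val * (x h).val ∂(μ : Measure (Γ → Spin)) =
      1 - 2 * (μ : Measure (Γ → Spin)).real {x | x g ≠ x h} := by
  have hC : MeasurableSet {x : Γ → Spin | x g ≠ x h} :=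
    (measurableSet_eq_fun (measurable_pi_apply g) (measurable_pi_apply h)).compl
  have hfun : (fun x : Γ → Spin => (x g).val * (x h).val) =
      fun x => 1 - 2 * {x : Γ → Spin | x g ≠ x h}.indicator 1 x := by
    funext x
    by_cases hx : x g = x h
    · rw [Set.indicator_of_notMem (by simpa using hx), hx]
      cases x h <;> simp [Spin.val]
    · rw [Set.indicator_of_mem (by exact hx)]
      revert hx
      cases x g <;> cases x h <;> simp [Spin.val] <;> norm_num
  have hint : Integrable ({x : Γ → Spin | x g ≠ x h}.indicator (1 : (Γ → Spin) → ℝ))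
      (μ : Measure (Γ → Spin)) := (integrable_const (1 : ℝ)).indicator hC
  rw [hfun]
  refine ⟨(integrable_const _).sub (hint.const_mul 2), ?_⟩
  rw [integral_sub (integrable_const _) (hint.const_mul 2), integral_const_mul,
    integral_indicator_one hC]
  simp

theorem integral_isingEnergy_freeBoundaryState (J : ℝ) :
    ∫ x, isingEnergy r J x ∂(freeBoundaryState r J : Measure (FreeGroup (Fin r) → Spin)) =
      -(r * J * (1 - 2 * (isingBeta J 0 : ℝ))) := by
  have hflip : ∀ l : Fin r × Bool, (freeBoundaryState r J : Measure (FreeGroup (Fin r) → Spin)).real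
      {x | x 1 ≠ x (FreeGroup.mk [l])} = isingBeta J 0 := fun l => by
    rw [Measure.real, freeBoundaryState_ne, ENNReal.toReal_ofReal (isingBeta J 0).2.1]
  have hof : ∀ i : Fin r, FreeGroup.of i = FreeGroup.mk [(i, true)] := fun i => rfl
  have hinv : ∀ i : Fin r, (FreeGroup.of i)⁻¹ = FreeGroup.mk [(i, false)] := fun i => by
    rw [hof, FreeGroup.inv_mk]
    rfl
  have hint := integral_spin_mul_spin (freeBoundaryState r J)
  unfold isingEnergy
  rw [integral_const_mul, integral_finsetSum _ fun i _ => by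
    exact (hint 1 (FreeGroup.of i)).1.add (hint 1 (FreeGroup.of i)⁻¹).1]
  simp_rw [integral_add (hint 1 _).1 (hint 1 _).1, (hint 1 _).2, hinv, hof, hflip]
  rw [Finset.sum_const, Finset.card_univ, Fintype.card_fin, nsmul_eq_mul]
  ring

/-- The Chernoff parameter 2J is the optimal one, because β = e^{-2J}/(1+e^{-2J}). The hypothesis
says that 2Jβ + L is less than the energy gap 2rJβ to the all-plus state. -/
theorem pressure_freeBoundaryState_lt {J : ℝ} (hr : 2 ≤ r) (hJ : 0 < J)
    (h : Real.log (1 + Real.exp (-(2 * J))) < 2 * (r - 1) * J * (isingBeta J 0 : ℝ))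
    {V : ℕ → Type*} [∀ n, Fintype (V n)] [∀ n, Nonempty (V n)]
    {σ : ∀ n, FreeGroup (Fin r) → Equiv.Perm (V n)} (hσ : IsSoficApproximation σ) :
    pressure σ (isingEnergy r J) (freeBoundaryState r J) < ((r * J : ℝ) : EReal) := by
  set β : ℝ := (isingBeta J 0 : ℝ)
  have hβ0 : 0 ≤ β := (isingBeta J 0).2.1
  set L := Real.log (1 + Real.exp (-(2 * J)))
  obtain ⟨c, hc1, hc2⟩ := exists_between (show 2 * J * β + L < 2 * r * J * β by linarith)
  -- The neighbourhood has to be open, so the flip frequency is allowed up to some `b` above β, with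
  -- 2Jb + L still below `c`.
  obtain ⟨b, hb1, hb2⟩ := exists_between (show β < (c - L) / (2 * J) by
    rw [lt_div_iff₀ (by positivity)]
    linarith)
  rw [lt_div_iff₀ (by positivity)] at hb2
  have hs : ∀ k, 1 ≤ k → (FreeGroup.mk [(⟨0, by omega⟩, true)] : FreeGroup (Fin r)) ^ k ≠ 1 := by
    intro k hk h
    have := congrArg (fun g => g.toWord.length) h
    change ((FreeGroup.of _) ^ k).toWord.length = _ at this
    rw [FreeGroup.toWord_of_pow] at this
    simp at this
    omega
  have hent : soficEntropy σ (freeBoundaryState r J) ≤ (c : EReal) := by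
    refine soficEntropy_le_of_flip_lt hσ hs (by positivity : 0 ≤ 2 * J) (hβ0.trans hb1.le) ?_ ?_
    · rw [freeBoundaryState_ne]
      exact (ENNReal.ofReal_lt_ofReal_iff_of_nonneg hβ0).2 hb1
    · linarith
  rw [pressure, integral_isingEnergy_freeBoundaryState]
  refine (EReal.sub_le_sub hent le_rfl).trans_lt ?_
  rw [← EReal.coe_sub, EReal.coe_lt_coe_iff]
  linarith

end FreeBoundaryPressure

/-! ### The thresholds -/

section Thresholds

variable {r : ℕ}

theorem two_mul_Juniq (hr : 2 ≤ r) : 2 * Juniq r = Real.log ((r : ℝ) / ((r : ℝ) - 1)) := by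
  have hr' : (2 : ℝ) ≤ r := by exact_mod_cast hr
  have h1 : 0 < 2 * (r : ℝ) - 1 := by linarith
  rw [Juniq, Real.artanh_eq_half_log]
  · have h2 : (1 + 1 / (2 * (r : ℝ) - 1)) / (1 - 1 / (2 * (r : ℝ) - 1)) = r / (r - 1) := by
      rw [div_eq_div_iff (by rw [sub_ne_zero, ne_comm, Ne, div_eq_one_iff_eq h1.ne']; linarith)
        (by linarith)]
      field_simp
      ring
    rw [h2]
    ring
  · refine ⟨by linarith [show 0 < 1 / (2 * (r : ℝ) - 1) by positivity], ?_⟩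
    rw [div_le_one h1]
    linarith

/-- The exponential equals ((r-1)/r)², and log(1+x) ≥ 2x/(x+2) at x = 1/(r-1) bounds the threshold
below by 2/(2r-1). What remains is (2r-1)² ≥ 2r². -/
theorem one_add_exp_le_of_two_mul_Juniq (hr : 2 ≤ r) :
    1 + Real.exp (-(2 * (2 * Juniq r))) ≤ 2 * (r - 1) * (2 * Juniq r) := by
  have hr' : (2 : ℝ) ≤ r := by exact_mod_cast hr
  have hr1 : (0 : ℝ) < r - 1 := by linarith
  have hexp : Real.exp (-(2 * (2 * Juniq r))) = ((r - 1) / r) ^ 2 := by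
    rw [two_mul_Juniq hr, ← mul_neg, ← Real.log_inv, inv_div, two_mul, Real.exp_add,
      Real.exp_log (by positivity), sq]
  have hlog : 2 / (2 * (r : ℝ) - 1) ≤ 2 * Juniq r := by
    have h := Real.le_log_one_add_of_nonneg (x := 1 / ((r : ℝ) - 1)) (by positivity)
    rw [two_mul_Juniq hr]
    convert h using 1
    · rw [div_eq_div_iff (by linarith) (by positivity)]
      field_simp
      ring
    · congr 1
      field_simp
      ring
  rw [hexp]
  refine le_trans ?_ (mul_le_mul_of_nonneg_left hlog (by positivity))
  rw [div_pow, mul_div_assoc', ← sub_nonneg]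
  have : 2 * ((r : ℝ) - 1) * 2 / (2 * r - 1) - (1 + (r - 1) ^ 2 / r ^ 2) =
      ((2 * r - 1) ^ 2 - 2 * r ^ 2) / ((2 * r - 1) * r ^ 2) := by
    have : 2 * (r : ℝ) - 1 ≠ 0 := by linarith
    field_simp
    ring
  rw [this]
  refine div_nonneg (by nlinarith) (mul_nonneg (by linarith) (by positivity))

/-- The first two terms of the power series; at r = 2 the linear term alone would be too weak in
`one_add_exp_le_of_Jrec`. -/
theorem add_cube_div_three_le_artanh {t : ℝ} (h0 : 0 ≤ t) (h1 : t < 1) :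
    t + t ^ 3 / 3 ≤ Real.artanh t := by
  have h := Real.sum_range_le_log_div h0 h1 2
  rw [Real.artanh_eq_half_log ⟨by linarith, h1.le⟩]
  norm_num [Finset.sum_range_succ] at h
  linarith

theorem one_add_exp_le_of_Jrec (hr : 2 ≤ r) :
    1 + Real.exp (-(2 * Jrec r)) ≤ 2 * (r - 1) * Jrec r := by
  have hr' : (2 : ℝ) ≤ r := by exact_mod_cast hr
  have h2r : 0 < 2 * (r : ℝ) - 1 := by linarith
  rw [Jrec]
  set t : ℝ := (2 * (r : ℝ) - 1) ^ (-(1 / 2) : ℝ) with ht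
  have ht0 : 0 < t := Real.rpow_pos_of_pos h2r _
  have htsq : t ^ 2 * (2 * r - 1) = 1 := by
    rw [ht, ← Real.rpow_natCast, ← Real.rpow_mul h2r.le]
    norm_num
    rw [Real.rpow_neg_one, inv_mul_cancel₀ h2r.ne']
  have ht3 : t ^ 2 ≤ 1 / 3 := by nlinarith [sq_nonneg t]
  -- The number 10/17 solves (20/27)(1+t) = 2t, where 20/27 is the value of (1-t²)(1+t²/3) at t² =
  -- 1/3, the case r = 2.
  have ht1 : t < 10 / 17 := by nlinarith
  have hexp : Real.exp (-(2 * Real.artanh t)) = (1 - t) / (1 + t) := by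
    rw [Real.artanh_eq_half_log ⟨by linarith, by linarith⟩, ← mul_assoc, mul_one_div_cancel two_ne_zero,
      one_mul, ← Real.log_inv, inv_div, Real.exp_log (div_pos (by linarith) (by linarith))]
  have hart := add_cube_div_three_le_artanh ht0.le (by linarith)
  rw [hexp]
  refine le_trans ?_ (mul_le_mul_of_nonneg_left hart (by linarith : 0 ≤ 2 * ((r : ℝ) - 1)))
  have hr1 : 2 * ((r : ℝ) - 1) = (1 - t ^ 2) / t ^ 2 := by
    rw [eq_div_iff (by positivity)]
    linarith
  have hkey : 2 * t ≤ (1 - t ^ 2) * (1 + t ^ 2 / 3) * (1 + t) := by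
    have : 20 / 27 ≤ (1 - t ^ 2) * (1 + t ^ 2 / 3) := by nlinarith [sq_nonneg t]
    have := mul_le_mul_of_nonneg_right this (by linarith : 0 ≤ 1 + t)
    linarith
  rw [hr1, show 1 + (1 - t) / (1 + t) = 2 / (1 + t) by field_simp; ring,
    show (1 - t ^ 2) / t ^ 2 * (t + t ^ 3 / 3) = (1 - t ^ 2) * (1 + t ^ 2 / 3) / t by field_simp,
    div_le_div_iff₀ (by linarith) ht0]
  exact hkey

/-- With x = e^{-2J} the goal is (1+x) log(1+x) < 2(r-1)Jx, which follows from log(1+x) < x and 1+x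
≤ 2(r-1)J. In the latter the left side decreases and the right side increases with J. -/
theorem log_one_add_exp_lt_of_le {J₀ J : ℝ} (hr : 2 ≤ r) (hJ : J₀ ≤ J)
    (h : 1 + Real.exp (-(2 * J₀)) ≤ 2 * (r - 1) * J₀) :
    0 < J ∧ Real.log (1 + Real.exp (-(2 * J))) < 2 * (r - 1) * J * (isingBeta J 0 : ℝ) := by
  have hr' : (2 : ℝ) ≤ r := by exact_mod_cast hr
  have hr1 : (0 : ℝ) < 2 * (r - 1) := by linarith
  have hJ0 : 0 < J₀ := pos_of_mul_pos_right ((by positivity : (0 : ℝ) <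
    1 + Real.exp (-(2 * J₀))).trans_le h) hr1.le
  have hx := Real.exp_pos (-(2 * J))
  have hle : 1 + Real.exp (-(2 * J)) ≤ 2 * (r - 1) * J := by
    have h1 : Real.exp (-(2 * J)) ≤ Real.exp (-(2 * J₀)) := Real.exp_le_exp.2 (by linarith)
    have h2 := mul_le_mul_of_nonneg_left hJ hr1.le
    linarith
  refine ⟨hJ0.trans_le hJ, ?_⟩
  have hβ : (isingBeta J 0 : ℝ) = Real.exp (-(2 * J)) / (1 + Real.exp (-(2 * J))) := by
    simp only [isingBeta, add_zero]
    rw [Real.exp_neg]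
    field_simp
  have hlog := Real.log_lt_sub_one_of_pos (by positivity : 0 < 1 + Real.exp (-(2 * J)))
    (by linarith)
  rw [hβ, mul_div_assoc', lt_div_iff₀ (by positivity)]
  have h1 := mul_lt_mul_of_pos_right hlog (by positivity : 0 < 1 + Real.exp (-(2 * J)))
  have h2 := mul_le_mul_of_nonneg_right hle hx.le
  linarith

end Thresholds

end SoficIsing

end

theorem theoremB (r : ℕ) (hr : 2 ≤ r) (J : ℝ)
    (hJ : min (2 * SoficIsing.Juniq r) (SoficIsing.Jrec r) ≤ J) :
    2 * SoficIsing.Juniq r = Real.log ((r : ℝ) / ((r : ℝ) - 1)) ∧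
    SoficIsing.ShiftInvariant (SoficIsing.freeBoundaryState r J) ∧
    ∀ (V : ℕ → Type*) [∀ n, Fintype (V n)] [∀ n, Nonempty (V n)]
      (σ : ∀ n, FreeGroup (Fin r) → Equiv.Perm (V n)),
      SoficIsing.IsSoficApproximation σ →
      ¬ SoficIsing.IsEquilibrium σ (SoficIsing.isingEnergy r J)
          (SoficIsing.freeBoundaryState r J) := by
  refine ⟨SoficIsing.two_mul_Juniq hr, SoficIsing.freeBoundaryState_shiftInvariant, ?_⟩
  intro V _ _ σ hσ heq
  have hbound : 0 < J ∧ Real.log (1 + Real.exp (-(2 * J))) <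
      2 * (r - 1) * J * (SoficIsing.isingBeta J 0 : ℝ) := by
    rcases min_le_iff.1 hJ with h | h
    · exact SoficIsing.log_one_add_exp_lt_of_le hr h (SoficIsing.one_add_exp_le_of_two_mul_Juniq hr)
    · exact SoficIsing.log_one_add_exp_lt_of_le hr h (SoficIsing.one_add_exp_le_of_Jrec hr)
  have hlt := SoficIsing.pressure_freeBoundaryState_lt hr hbound.1 hbound.2 hσ
  have hle := heq.2 _ (SoficIsing.plusState_shiftInvariant _)
  exact absurd ((SoficIsing.le_pressure_plusState J σ).trans hle) (not_le.2 hlt)
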